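/- Let $d\ge 0$, $n\ge 1$ be integers and let $\mathcal S\subset\{0,1\}^d$ be a nonempty set of actions such that for every $i\in\{1,\dots,d\}$ there is $v\in\mathcal S$ with $v_i=1$. Consider the semi-bandit game: in each round $t=1,\dots,n$ the forecaster draws $V_t\in\mathcal S$ from a distribution $p_t$ on $\mathcal S$ determined by the past, while simultaneously the adversary selects a loss vector $\ell_t\in[0,+\infty)^d$, possibly at random and depending on the past of the game, such that conditionally on the past and on $\ell_t$ the action $V_t$ has law $p_t$; the forecaster suffers the loss $\ell_t^TV_t$ and observes only the coordinates $\ell_{i,t}$ with $V_{i,t}=1$. Its regret is $$\overline R_n=\mathbb E\sum_{t=1}^n \ell_t^TV_t-\min_{v\in\mathcal S}\mathbb E\sum_{t=1}^n\ell_t^Tv .$$ Assume the $L_\infty$ condition $\|\ell_t\|_\infty\le 1$ for all $t=1,\dots,n$. Let $\eta=\sqrt{2/n}$, $\mathcal D=[0,+\infty)^d$, $F(u)=\frac1\eta\sum_{i=1}^d u_i\log u_i$ on $\mathcal D$ (with $0\log 0=0$), and $D_F(u,v)=F(u)-F(v)-(u-v)^T\nabla F(v)$ for $u\in\mathcal D$,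 $v\in\mathrm{Int}(\mathcal D)$. Suppose that the forecaster uses LINEXP, that is, the following strategy, started from $$w_1=\mathop{\mathrm{argmin}}_{w\in\mathrm{Conv}(\mathcal S)}D_F\big(w,(1,\dots,1)^T\big).$$ In each round $t=1,\dots,n$: (a) choose a distribution $p_t$ on $\mathcal S$ with mean $\mathbb E_{V\sim p_t}V=w_t$ and draw $V_t$ from $p_t$; (b) form the estimate $\tilde\ell_{i,t}=\ell_{i,t}\,V_{i,t}/w_{i,t}$, $i=1,\dots,d$; (c) let $w'_{t+1}\in\mathrm{Int}(\mathcal D)$ satisfy $\nabla F(w'_{t+1})=\nabla F(w_t)-\tilde\ell_t$, and let $w_{t+1}\in\mathop{\mathrm{argmin}}_{w\in\mathrm{Conv}(\mathcal S)\cap\mathrm{Int}(\mathcal D)}D_F(w,w'_{t+1})$. Then $$\overline R_n\le d\sqrt{2n}.$$ -/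

import Mathlib

open MeasureTheory ProbabilityTheory

noncomputable section

namespace CombPred

/-- `ℝ^d` with its standard inner product. -/
abbrev Vec (d : ℕ) := EuclideanSpace ℝ (Fin d)

/-- The Bregman divergence `D_F(u,v) = F(u) - F(v) - (u-v)ᵀ ∇F(v)`. -/
def bregman {d : ℕ} (F : Vec d → ℝ) (u v : Vec d) : ℝ :=
  F u - F v - inner ℝ (u - v) (gradient F v)

/-- `w ∈ argmin_{u ∈ K} D_F(u, x)`. -/
def IsBregmanProj {d : ℕ} (F : Vec d → ℝ) (K : Set (Vec d)) (x w : Vec d) : Prop :=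
  w ∈ K ∧ ∀ u ∈ K, bregman F w x ≤ bregman F u x

/-- The update of CLEB (Combinatorial LEarning with Bregman projections) with Legendre function
`F` on `D`, from `w` to `wNext`, with loss estimate `lossEst`: a gradient step to a point `w'` of
`Int(D)` with `∇F(w') = ∇F(w) - lossEst`, followed by the Bregman projection of `w'` on
`Conv(S) ∩ Int(D)`. -/
def ClebUpdate {d : ℕ} (D : Set (Vec d)) (F : Vec d → ℝ) (S : Finset (Vec d))
    (w lossEst wNext : Vec d) : Prop :=
  ∃ w' ∈ interior D, gradient F w' = gradient F w - lossEst ∧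
    IsBregmanProj F (convexHull ℝ (S : Set (Vec d)) ∩ interior D) w' wNext

/-- The domain `[0,+∞)^d` of LINEXP. -/
def orthant (d : ℕ) : Set (Vec d) := {u | ∀ i, 0 ≤ u i}

/-- The Legendre function of LINEXP: `F(u) = (1/η) ∑ᵢ uᵢ log uᵢ` (with `0 log 0 = 0`). -/
def negEntropy {d : ℕ} (η : ℝ) (u : Vec d) : ℝ :=
  (1 / η) * ∑ i, u i * Real.log (u i)

/-- The importance-weighted estimate `ℓᵢ Vᵢ / wᵢ` of the semi-bandit game; it depends on the loss
vector `ℓ` only through the observed coordinates, those with `Vᵢ = 1`. -/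
def semiBanditEstimate {d : ℕ} (l V w : Vec d) : Vec d :=
  WithLp.toLp 2 fun i => l i * (V i / w i)

/-- `p` gives the weights of a probability distribution on the finite set `S` with mean `w`. -/
structure IsDistWithMean {d : ℕ} (S : Finset (Vec d)) (p : Vec d → ℝ) (w : Vec d) : Prop where
  nonneg : ∀ v ∈ S, 0 ≤ p v
  sum_eq_one : ∑ v ∈ S, p v = 1
  mean_eq : ∑ v ∈ S, p v • v = w

/-- The protocol of an `n`-round prediction game with action set `S`. The rounds are
`t = 1, …, n`, and `𝓕 t` is the information generated up to the end of round `t` (past actions,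
past loss vectors, private randomization). In round `t` the forecaster draws the action `V t ∈ S`
from the distribution `p t`, which is determined by `𝓕 (t-1)`; simultaneously the adversary
selects the nonnegative loss vector `ℓ t`, possibly at random and depending on the past, but
without knowing the draw: given `𝓕 (t-1)` and `ℓ t`, the conditional law of `V t` is `p t`. -/
structure IsGame {Ω : Type*} [mΩ : MeasurableSpace Ω] (μ : Measure Ω) (𝓕 : Filtration ℕ mΩ)
    {d : ℕ} (S : Finset (Vec d)) (n : ℕ) (l V : ℕ → Ω → Vec d) (p : ℕ → Ω → Vec d → ℝ) :
    Prop where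
  loss_measurable : ∀ t ∈ Finset.Icc 1 n, Measurable[𝓕 t] (l t)
  loss_nonneg : ∀ t ∈ Finset.Icc 1 n, ∀ ω i, 0 ≤ l t ω i
  action_measurable : ∀ t ∈ Finset.Icc 1 n, Measurable[𝓕 t] (V t)
  action_mem : ∀ t ∈ Finset.Icc 1 n, ∀ ω, V t ω ∈ S
  dist_measurable : ∀ t ∈ Finset.Icc 1 n, ∀ v ∈ S, Measurable[𝓕 (t - 1)] fun ω => p t ω v
  action_law : ∀ t ∈ Finset.Icc 1 n, ∀ v ∈ S,
    μ[(V t ⁻¹' {v}).indicator (fun _ => (1 : ℝ)) |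
        𝓕 (t - 1) ⊔ MeasurableSpace.comap (l t) inferInstance] =ᵐ[μ] fun ω => p t ω v

/-- The forecaster follows LINEXP with learning rate `η`, i.e. CLEB with `D = [0,+∞)^d` and
`F(u) = (1/η) ∑ᵢ uᵢ log uᵢ`, started at `w₁`, with the semi-bandit estimates: in each round the
sampling distribution `p t` is any distribution on `S` with mean `w t`, and `w (t+1)` is the
CLEB update of `w t`. -/
structure IsLinexp {Ω : Type*} {d : ℕ} (η : ℝ) (S : Finset (Vec d)) (n : ℕ) (w₁ : Vec d)
    (l V : ℕ → Ω → Vec d) (p : ℕ → Ω → Vec d → ℝ) (w : ℕ → Ω → Vec d) : Prop where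
  init : ∀ ω, w 1 ω = w₁
  dist : ∀ t ∈ Finset.Icc 1 n, ∀ ω, IsDistWithMean S (p t ω) (w t ω)
  update : ∀ t ∈ Finset.Icc 1 n, ∀ ω,
    ClebUpdate (orthant d) (negEntropy η) S (w t ω)
      (semiBanditEstimate (l t ω) (V t ω) (w t ω)) (w (t + 1) ω)

/-- The regret `E ∑ₜ ℓₜᵀ Vₜ - min_{v ∈ S} E ∑ₜ ℓₜᵀ v`. -/
def regret {Ω : Type*} [MeasurableSpace Ω] (μ : Measure Ω) {d : ℕ} (S : Finset (Vec d))
    (hS : S.Nonempty) (n : ℕ) (l V : ℕ → Ω → Vec d) : ℝ :=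
  (∫ ω, ∑ t ∈ Finset.Icc 1 n, inner ℝ (l t ω) (V t ω) ∂μ) -
    S.inf' hS fun v => ∫ ω, ∑ t ∈ Finset.Icc 1 n, inner ℝ (l t ω) v ∂μ

end CombPred

end

/-!
LINEXP is mirror descent for the negative entropy. By the generalized Pythagorean inequality, one
update decreases `D_F(u, ·)` by at least `ℓ̃ₜᵀ(wₜ - u)`, up to the stability term
`D_F(wₜ, w'ₜ₊₁) ≤ (η/2) ∑ᵢ wᵢ ℓ̃ᵢ²`, which follows from `exp(-x) ≤ 1 - x + x²/2` for `x ≥ 0`.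
Since `Vₜ` has conditional mean `wₜ`, the importance-weighted estimates are unbiased and the
stability term has expectation at most `(η/2) E‖ℓₜ‖²`.

The weights `1 / wᵢ` are finite, because the entropy has infinite slope at the boundary of the
orthant, but they are not bounded. Integrability of the estimates therefore comes from pulling
`ℓᵢ / wᵢ` out of the conditional expectation at the level of nonnegative integrals.
-/

namespace CombPred

open InformationTheory

variable {d : ℕ}

section Bregman

variable {F : Vec d → ℝ}

theorem bregman_eq_add_add_inner (F : Vec d → ℝ) (u w x : Vec d) :
    bregman F u x = bregman F u w + bregman F w x +
      inner ℝ (u - w) (gradient F w - gradient F x) := by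
  have hsplit : u - x = (u - w) + (w - x) := by abel
  simp only [bregman, hsplit, inner_add_left, inner_sub_right]
  ring

theorem IsBregmanProj.inner_nonneg {K : Set (Vec d)} {u w x : Vec d}
    (h : IsBregmanProj F K x w) (hF : DifferentiableAt ℝ F w) (huw : openSegment ℝ w u ⊆ K) :
    0 ≤ inner ℝ (u - w) (gradient F w - gradient F x) := by
  have hmin : IsMinOn (fun y => F y - inner ℝ (gradient F x) y) K w := fun y hy => by
    have := h.2 y hy
    simp only [bregman, real_inner_comm (gradient F x), inner_sub_right] at this
    change F w - _ ≤ F y - _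
    linarith
  have hderiv : HasFDerivAt (fun y => F y - inner ℝ (gradient F x) y)
      (innerSL ℝ (gradient F w) - innerSL ℝ (gradient F x)) w :=
    hF.hasGradientAt.hasFDerivAt.sub (innerSL ℝ (gradient F x)).hasFDerivAt
  have := hmin.localize.hasFDerivWithinAt_nonneg hderiv.hasFDerivWithinAt
    (sub_mem_posTangentConeAt_of_openSegment_subset huw)
  simpa only [sub_apply, innerSL_apply_apply, ← inner_sub_left, real_inner_comm] using this

theorem IsBregmanProj.bregman_add_bregman_le {K : Set (Vec d)} {u w x : Vec d}
    (h : IsBregmanProj F K x w) (hF : DifferentiableAt ℝ F w) (huw : openSegment ℝ w u ⊆ K) :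
    bregman F u w + bregman F w x ≤ bregman F u x := by
  linarith [bregman_eq_add_add_inner F u w x, h.inner_nonneg hF huw]

theorem ClebUpdate.mem_interior {D : Set (Vec d)} {S : Finset (Vec d)} {w g wNext : Vec d}
    (h : ClebUpdate D F S w g wNext) : wNext ∈ interior D :=
  let ⟨_, _, _, hproj⟩ := h
  hproj.1.2

theorem ClebUpdate.mem_convexHull {D : Set (Vec d)} {S : Finset (Vec d)} {w g wNext : Vec d}
    (h : ClebUpdate D F S w g wNext) : wNext ∈ convexHull ℝ (S : Set (Vec d)) :=
  let ⟨_, _, _, hproj⟩ := h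
  hproj.1.1

theorem ClebUpdate.exists_inner_sub_le {D : Set (Vec d)} {S : Finset (Vec d)}
    {w g wNext u : Vec d} (h : ClebUpdate D F S w g wNext) (hD : Convex ℝ D)
    (hF : DifferentiableAt ℝ F wNext) (huS : u ∈ convexHull ℝ (S : Set (Vec d))) (huD : u ∈ D) :
    ∃ w' ∈ interior D, gradient F w' = gradient F w - g ∧
      inner ℝ g (w - u) ≤
        bregman F u w - bregman F u wNext + bregman F w w' - bregman F wNext w' := by
  obtain ⟨w', hw', hgrad, hproj⟩ := h
  refine ⟨w', hw', hgrad, ?_⟩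
  have hseg : openSegment ℝ wNext u ⊆ convexHull ℝ (S : Set (Vec d)) ∩ interior D :=
    Set.subset_inter ((convex_convexHull ℝ _).openSegment_subset hproj.1.1 huS)
      (hD.openSegment_interior_self_subset_interior hproj.1.2 huD)
  have hpyth := hproj.bregman_add_bregman_le hF hseg
  have hstep := bregman_eq_add_add_inner F u w w'
  have hinner : inner ℝ (u - w) (gradient F w - gradient F w') = -inner ℝ g (w - u) := by
    rw [hgrad, sub_sub_cancel, ← inner_neg_right, neg_sub, real_inner_comm]
  linarith

end Bregman

section NegEntropy

theorem convex_orthant (d : ℕ) : Convex ℝ (orthant d) :=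
  fun _ hu _ hv _ _ ha hb _ i => add_nonneg (mul_nonneg ha (hu i)) (mul_nonneg hb (hv i))

theorem mem_interior_orthant {u : Vec d} : u ∈ interior (orthant d) ↔ ∀ i, 0 < u i := by
  have hpre : orthant d = (EuclideanSpace.equiv (Fin d) ℝ).toHomeomorph ⁻¹'
      (Set.pi Set.univ fun _ => Set.Ici (0 : ℝ)) := by
    ext u
    exact ⟨fun hu i _ => hu i, fun hu i => hu i trivial⟩
  rw [hpre, ← Homeomorph.preimage_interior, interior_pi_set Set.finite_univ]
  simp

theorem hasGradientAt_negEntropy (η : ℝ) {x : Vec d} (hx : ∀ i, 0 < x i) :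
    HasGradientAt (negEntropy η) (WithLp.toLp 2 fun i => 1 / η * (Real.log (x i) + 1)) x := by
  have hcoord : ∀ i, HasFDerivAt (fun u : Vec d => u i * Real.log (u i))
      ((Real.log (x i) + 1) • (EuclideanSpace.proj i : Vec d →L[ℝ] ℝ)) x := fun i =>
    (Real.hasDerivAt_mul_log (hx i).ne').comp_hasFDerivAt (f := fun u : Vec d => u i) x
      (EuclideanSpace.proj i : Vec d →L[ℝ] ℝ).hasFDerivAt
  have hsum := (HasFDerivAt.fun_sum (u := Finset.univ) fun i _ => hcoord i).const_mul (1 / η)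
  rw [hasGradientAt_iff_hasFDerivAt]
  refine hsum.congr_fderiv (ContinuousLinearMap.ext fun v => ?_)
  simp only [one_div, smul_apply, sum_apply, PiLp.proj_apply, smul_eq_mul,
    InnerProductSpace.toDual_apply_apply, PiLp.inner_apply, RCLike.inner_apply, conj_trivial,
    Finset.mul_sum]
  exact Finset.sum_congr rfl fun i _ => by ring

theorem bregman_negEntropy (η : ℝ) (u : Vec d) {x : Vec d} (hx : ∀ i, 0 < x i) :
    bregman (negEntropy η) u x = 1 / η * ∑ i, x i * klFun (u i / x i) := by
  rw [bregman, (hasGradientAt_negEntropy η hx).gradient]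
  simp only [negEntropy, PiLp.inner_apply, Finset.mul_sum, ← Finset.sum_sub_distrib]
  refine Finset.sum_congr rfl fun i _ => ?_
  have hxi := (hx i).ne'
  rcases eq_or_ne (u i) 0 with hui | hui
  · simp only [hui, klFun_zero, PiLp.sub_apply, RCLike.inner_apply, conj_trivial, zero_div]
    ring
  · simp only [klFun_apply, Real.log_div hui hxi, PiLp.sub_apply, RCLike.inner_apply, conj_trivial]
    field_simp
    ring

theorem bregman_negEntropy_nonneg {η : ℝ} (hη : 0 ≤ η) {u x : Vec d} (hu : ∀ i, 0 ≤ u i)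
    (hx : ∀ i, 0 < x i) : 0 ≤ bregman (negEntropy η) u x := by
  rw [bregman_negEntropy η u hx]
  have := fun i => klFun_nonneg (div_nonneg (hu i) (hx i).le)
  exact mul_nonneg (by positivity)
    (Finset.sum_nonneg fun i _ => mul_nonneg (hx i).le (this i))

theorem klFun_le_one {x : ℝ} (hx : x ∈ Set.Icc (0 : ℝ) 1) : klFun x ≤ 1 := by
  have := mul_nonpos_of_nonneg_of_nonpos hx.1 (Real.log_nonpos hx.1 hx.2)
  rw [klFun_apply]
  linarith [hx.1]

theorem bregman_negEntropy_one_le {η : ℝ} (hη : 0 ≤ η) {u : Vec d}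
    (hu : ∀ i, u i ∈ Set.Icc (0 : ℝ) 1) :
    bregman (negEntropy η) u (WithLp.toLp 2 fun _ => 1) ≤ d / η := by
  rw [bregman_negEntropy η u fun _ => one_pos]
  calc 1 / η * ∑ i, 1 * klFun (u i / 1) ≤ 1 / η * ∑ _i : Fin d, (1 : ℝ) := by
        gcongr with i
        simpa using klFun_le_one (hu i)
    _ = d / η := by simp [div_eq_inv_mul]

theorem exp_neg_le_one_sub_add_sq_div_two {x : ℝ} (hx : 0 ≤ x) :
    Real.exp (-x) ≤ 1 - x + x ^ 2 / 2 := by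
  rw [Real.exp_neg, inv_le_iff_one_le_mul₀ (Real.exp_pos x)]
  calc (1 : ℝ) ≤ (1 - x + x ^ 2 / 2) * (1 + x + x ^ 2 / 2) := by nlinarith [sq_nonneg (x ^ 2)]
    _ ≤ (1 - x + x ^ 2 / 2) * Real.exp x := by
        gcongr
        · nlinarith [sq_nonneg (x - 1)]
        · exact Real.quadratic_le_exp_of_nonneg hx

theorem eq_mul_exp_of_gradient_negEntropy_eq_sub {η : ℝ} (hη : η ≠ 0) {w w' g : Vec d}
    (hw : ∀ i, 0 < w i) (hw' : ∀ i, 0 < w' i)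
    (hgrad : gradient (negEntropy η) w' = gradient (negEntropy η) w - g) (i : Fin d) :
    w' i = w i * Real.exp (-(η * g i)) := by
  rw [(hasGradientAt_negEntropy η hw').gradient, (hasGradientAt_negEntropy η hw).gradient] at hgrad
  have hcoord := congrArg (fun v : Vec d => v i) hgrad
  simp only [PiLp.sub_apply] at hcoord
  have hlog : Real.log (w' i) = Real.log (w i) + -(η * g i) := by
    field_simp at hcoord
    linarith
  rw [← Real.exp_log (hw' i), hlog, Real.exp_add, Real.exp_log (hw i)]

theorem bregman_negEntropy_le_of_gradient_eq_sub {η : ℝ} (hη : 0 < η) {w w' g : Vec d}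
    (hw : ∀ i, 0 < w i) (hw' : ∀ i, 0 < w' i) (hg : ∀ i, 0 ≤ g i)
    (hgrad : gradient (negEntropy η) w' = gradient (negEntropy η) w - g) :
    bregman (negEntropy η) w w' ≤ η / 2 * ∑ i, w i * g i ^ 2 := by
  have hterm : ∀ i, w' i * klFun (w i / w' i) ≤ w i * ((η * g i) ^ 2 / 2) := fun i => by
    have hw'i := eq_mul_exp_of_gradient_negEntropy_eq_sub hη.ne' hw hw' hgrad i
    have hratio : w i / w' i = Real.exp (η * g i) := by
      rw [hw'i, Real.exp_neg]
      have := (hw i).ne'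
      field_simp
    calc w' i * klFun (w i / w' i)
        = w i * (η * g i + Real.exp (-(η * g i)) - 1) := by
          rw [hratio, hw'i, klFun_apply, Real.log_exp, Real.exp_neg]
          field_simp
      _ ≤ w i * ((η * g i) ^ 2 / 2) := by
          have := exp_neg_le_one_sub_add_sq_div_two (mul_nonneg hη.le (hg i))
          exact mul_le_mul_of_nonneg_left (by linarith) (hw i).le
  calc bregman (negEntropy η) w w' = 1 / η * ∑ i, w' i * klFun (w i / w' i) :=
        bregman_negEntropy η w hw'
    _ ≤ 1 / η * ∑ i, w i * ((η * g i) ^ 2 / 2) := by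
        gcongr 1 / η * ?_
        exact Finset.sum_le_sum fun i _ => hterm i
    _ = η / 2 * ∑ i, w i * g i ^ 2 := by
        simp only [Finset.mul_sum]
        refine Finset.sum_congr rfl fun i _ => ?_
        field_simp

theorem ClebUpdate.inner_sub_le_of_negEntropy {η : ℝ} (hη : 0 < η) {S : Finset (Vec d)}
    {w g wNext u : Vec d} (h : ClebUpdate (orthant d) (negEntropy η) S w g wNext)
    (hw : ∀ i, 0 < w i) (hg : ∀ i, 0 ≤ g i) (huS : u ∈ convexHull ℝ (S : Set (Vec d)))
    (hu : u ∈ orthant d) :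
    inner ℝ g (w - u) ≤ bregman (negEntropy η) u w - bregman (negEntropy η) u wNext +
      η / 2 * ∑ i, w i * g i ^ 2 := by
  have hwNext := mem_interior_orthant.1 h.mem_interior
  obtain ⟨w', hw', hgrad, hle⟩ := h.exists_inner_sub_le (convex_orthant d)
    (hasGradientAt_negEntropy η hwNext).differentiableAt huS hu
  rw [mem_interior_orthant] at hw'
  linarith [bregman_negEntropy_le_of_gradient_eq_sub hη hw hw' hg hgrad,
    bregman_negEntropy_nonneg hη.le (fun i => (hwNext i).le) hw']

theorem klFun_convexCombo_le {a b s : ℝ} (ha : 0 ≤ a) (hb : 0 ≤ b) (hs : s ∈ Set.Icc (0 : ℝ) 1) :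
    klFun ((1 - s) * a + s * b) ≤ klFun a + s * (klFun b - klFun a) := by
  have := convexOn_klFun.2 ha hb (sub_nonneg.2 hs.2) hs.1 (sub_add_cancel 1 s)
  simp only [smul_eq_mul] at this
  linarith

theorem klFun_mul_eq (b s : ℝ) :
    klFun (s * b) = klFun 0 + s * (klFun b - klFun 0) + b * (s * Real.log s) := by
  rcases eq_or_ne s 0 with rfl | hs
  · simp
  rcases eq_or_ne b 0 with rfl | hb
  · simp
  simp only [klFun_apply, Real.log_mul hs hb]
  ring

theorem bregman_negEntropy_add_smul_le_of_eq_zero {η : ℝ} (hη : 0 ≤ η) {u w x : Vec d}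
    (hu : ∀ i, 0 ≤ u i) (hw : ∀ i, 0 ≤ w i) (hx : ∀ i, 0 < x i) {j : Fin d} (hj : w j = 0)
    {s : ℝ} (hs : s ∈ Set.Icc (0 : ℝ) 1) :
    bregman (negEntropy η) (w + s • (u - w)) x ≤
      bregman (negEntropy η) w x +
        s * (bregman (negEntropy η) u x - bregman (negEntropy η) w x) +
        1 / η * (u j * (s * Real.log s)) := by
  have hcoord : ∀ i, x i * klFun ((w + s • (u - w)) i / x i) ≤
      x i * klFun (w i / x i) + s * (x i * klFun (u i / x i) - x i * klFun (w i / x i)) +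
        if i = j then u j * (s * Real.log s) else 0 := fun i => by
    have hxi := (hx i).ne'
    have hcombo : (w + s • (u - w)) i / x i = (1 - s) * (w i / x i) + s * (u i / x i) := by
      simp only [PiLp.add_apply, PiLp.smul_apply, PiLp.sub_apply, smul_eq_mul]
      ring
    rw [hcombo]
    split_ifs with hij
    · subst hij
      rw [hj, zero_div, mul_zero, zero_add, klFun_mul_eq]
      field_simp
      exact le_rfl
    · have := mul_le_mul_of_nonneg_left (klFun_convexCombo_le (div_nonneg (hw i) (hx i).le)
        (div_nonneg (hu i) (hx i).le) hs) (hx i).le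
      linarith
  have hsum := Finset.sum_le_sum fun i (_ : i ∈ Finset.univ) => hcoord i
  rw [Finset.sum_add_distrib, Finset.sum_add_distrib, ← Finset.mul_sum, Finset.sum_sub_distrib,
    Finset.sum_ite_eq' Finset.univ j, if_pos (Finset.mem_univ j)] at hsum
  simp only [bregman_negEntropy η _ hx]
  refine (mul_le_mul_of_nonneg_left hsum (one_div_nonneg.2 hη)).trans_eq ?_
  ring

-- The entropy has slope `-∞` at the boundary of the orthant, so a minimizer avoids it.
theorem IsBregmanProj.pos_of_pos {η : ℝ} (hη : 0 < η) {C : Set (Vec d)} {u w x : Vec d}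
    (h : IsBregmanProj (negEntropy η) C x w) (hC : Convex ℝ C) (hC0 : C ⊆ orthant d)
    (hx : ∀ i, 0 < x i) (hu : u ∈ C) {j : Fin d} (huj : 0 < u j) : 0 < w j := by
  refine (hC0 h.1 j).lt_of_ne' fun hj => ?_
  set gap := bregman (negEntropy η) u x - bregman (negEntropy η) w x
  have hlog : ∀ s ∈ Set.Ioo (0 : ℝ) 1, 0 ≤ gap + u j / η * Real.log s := fun s hs => by
    have hs' : s ∈ Set.Icc (0 : ℝ) 1 := Set.Ioo_subset_Icc_self hs
    have hmin := (h.2 _ (hC.add_smul_sub_mem h.1 hu hs')).trans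
      (bregman_negEntropy_add_smul_le_of_eq_zero hη.le (hC0 hu) (hC0 h.1) hx hj hs')
    refine nonneg_of_mul_nonneg_right ?_ hs.1
    calc 0 ≤ s * gap + 1 / η * (u j * (s * Real.log s)) := by linarith
      _ = s * (gap + u j / η * Real.log s) := by ring
  have hbot : Filter.Tendsto (fun s => gap + u j / η * Real.log s) (nhdsWithin 0 (Set.Ioi 0))
      Filter.atBot :=
    Filter.tendsto_atBot_add_const_left _ _
      (Real.tendsto_log_nhdsGT_zero.const_mul_atBot (div_pos huj hη))
  obtain ⟨s, hneg, hs⟩ :=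
    ((hbot.eventually_lt_atBot 0).and (Ioo_mem_nhdsGT (zero_lt_one' ℝ))).exists
  exact (hlog s hs).not_gt hneg

end NegEntropy

section CondExp

variable {Ω : Type*} {m m₀ : MeasurableSpace Ω} {μ : Measure[m₀] Ω}

theorem lintegral_mul_condLExp (hm : m ≤ m₀) [SigmaFinite (μ.trim hm)] {f X : Ω → ENNReal}
    (hf : Measurable[m] f) (hX : AEMeasurable X μ) :
    ∫⁻ ω, f ω * (μ⁻[X | m]) ω ∂μ = ∫⁻ ω, f ω * X ω ∂μ := by
  have htrim : (μ.withDensity (μ⁻[X | m])).trim hm = (μ.withDensity X).trim hm := by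
    refine @Measure.ext _ m _ _ fun A hA => ?_
    rw [trim_measurableSet_eq hm hA, trim_measurableSet_eq hm hA, withDensity_apply _ (hm A hA),
      withDensity_apply _ (hm A hA), setLIntegral_condLExp hm μ X hA]
  have hf₀ : AEMeasurable f μ := (hf.mono hm le_rfl).aemeasurable
  have hweighted := congrArg (fun ν => ∫⁻ ω, f ω ∂ν) htrim
  simp only [lintegral_trim hm hf] at hweighted
  rw [lintegral_withDensity_eq_lintegral_mul _ (measurable_condLExp' m μ X) (hf.mono hm le_rfl),
    lintegral_withDensity_eq_lintegral_mul₀ hX hf₀] at hweighted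
  simpa only [Pi.mul_apply, mul_comm] using hweighted

theorem integrable_mul_div_condExp (hm : m ≤ m₀) [SigmaFinite (μ.trim hm)] {g X : Ω → ℝ}
    (hg : StronglyMeasurable[m] g) (hgi : Integrable g μ) (hX : Integrable X μ)
    (hX0 : 0 ≤ᵐ[μ] X) : Integrable (fun ω => g ω * (X ω / (μ[X | m]) ω)) μ := by
  have hratio : StronglyMeasurable[m] fun ω => g ω / (μ[X | m]) ω :=
    (hg.measurable.div stronglyMeasurable_condExp.measurable).stronglyMeasurable
  have hcomm : (fun ω => g ω * (X ω / (μ[X | m]) ω)) = fun ω => g ω / (μ[X | m]) ω * X ω :=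
    funext fun ω => by ring
  rw [hcomm]
  refine ⟨(hratio.mono hm).aestronglyMeasurable.mul hX.1, ?_⟩
  calc ∫⁻ ω, ‖g ω / (μ[X | m]) ω * X ω‖ₑ ∂μ
      = ∫⁻ ω, ‖g ω / (μ[X | m]) ω‖ₑ * ‖X ω‖ₑ ∂μ := by simp only [enorm_mul]
    _ = ∫⁻ ω, ‖g ω / (μ[X | m]) ω‖ₑ * (μ⁻[fun ω => ‖X ω‖ₑ | m]) ω ∂μ :=
        (lintegral_mul_condLExp hm hratio.enorm hX.1.enorm).symm
    _ = ∫⁻ ω, ‖g ω / (μ[X | m]) ω * (μ[X | m]) ω‖ₑ ∂μ :=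
        lintegral_congr_ae <| (condLExp_enorm m hX hX0).mono fun ω hω => by
          simp only [hω, enorm_mul]
    _ ≤ ∫⁻ ω, ‖g ω‖ₑ ∂μ := by
        refine lintegral_mono fun ω => ?_
        rcases eq_or_ne ((μ[X | m]) ω) 0 with h | h
        · simp [h]
        · rw [div_mul_cancel₀ _ h]
    _ < ⊤ := hgi.2

theorem integral_mul_div_condExp (hm : m ≤ m₀) [SigmaFinite (μ.trim hm)] {g X : Ω → ℝ}
    (hg : StronglyMeasurable[m] g) (hgi : Integrable g μ) (hX : Integrable X μ)
    (hX0 : 0 ≤ᵐ[μ] X) (hne : ∀ᵐ ω ∂μ, (μ[X | m]) ω ≠ 0) :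
    ∫ ω, g ω * (X ω / (μ[X | m]) ω) ∂μ = ∫ ω, g ω ∂μ := by
  have hratio : StronglyMeasurable[m] fun ω => g ω / (μ[X | m]) ω :=
    (hg.measurable.div stronglyMeasurable_condExp.measurable).stronglyMeasurable
  have hcomm : (fun ω => g ω * (X ω / (μ[X | m]) ω)) = (fun ω => g ω / (μ[X | m]) ω) * X :=
    funext fun ω => by simp only [Pi.mul_apply]; ring
  have hint := integrable_mul_div_condExp hm hg hgi hX hX0
  rw [hcomm] at hint ⊢
  rw [← integral_condExp hm]
  refine integral_congr_ae ?_
  filter_upwards [condExp_mul_of_stronglyMeasurable_left hratio hint hX, hne] with ω hpull hω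
  rw [hpull, Pi.mul_apply, div_mul_cancel₀ _ hω]

end CondExp

section Linexp

variable {Ω : Type*} {n t : ℕ} {η : ℝ} {S : Finset (Vec d)} {u w₁ : Vec d}
  {l V w : ℕ → Ω → Vec d} {p : ℕ → Ω → Vec d → ℝ}

theorem semiBanditEstimate_nonneg {l V w : Vec d} (hl : ∀ i, 0 ≤ l i) (hV : ∀ i, 0 ≤ V i)
    (hw : ∀ i, 0 ≤ w i) (i : Fin d) : 0 ≤ semiBanditEstimate l V w i :=
  mul_nonneg (hl i) (div_nonneg (hV i) (hw i))

theorem inner_semiBanditEstimate_self (l V : Vec d) {w : Vec d} (hw : ∀ i, w i ≠ 0) :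
    inner ℝ (semiBanditEstimate l V w) w = inner ℝ l V := by
  simp only [PiLp.inner_apply, semiBanditEstimate, RCLike.inner_apply, conj_trivial]
  refine Finset.sum_congr rfl fun i _ => ?_
  have := hw i
  field_simp

theorem mul_semiBanditEstimate_sq_le {l V w : Vec d} {i : Fin d} (hV : V i ∈ Set.Icc (0 : ℝ) 1)
    (hw : 0 < w i) : w i * semiBanditEstimate l V w i ^ 2 ≤ l i ^ 2 * (V i / w i) := by
  have hVsq : V i ^ 2 ≤ V i := by nlinarith [hV.1, hV.2]
  calc w i * semiBanditEstimate l V w i ^ 2 = l i ^ 2 * (V i ^ 2 / w i) := by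
        simp only [semiBanditEstimate]
        field_simp
    _ ≤ l i ^ 2 * (V i / w i) := by gcongr

theorem IsLinexp.init_pos [Nonempty Ω] (h : IsLinexp η S n w₁ l V p w) (hn : 1 ≤ n) (hη : 0 < η)
    (hS : (S : Set (Vec d)) ⊆ orthant d) {x : Vec d} (hx : ∀ i, 0 < x i)
    (hw₁ : IsBregmanProj (negEntropy η) (convexHull ℝ (S : Set (Vec d))) x w₁) (i : Fin d) :
    0 < w₁ i := by
  obtain ⟨ω⟩ := ‹Nonempty Ω›
  have hround := h.update 1 (Finset.mem_Icc.2 ⟨le_rfl, hn⟩) ω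
  exact hw₁.pos_of_pos hη (convex_convexHull ℝ _) (convexHull_min hS (convex_orthant d)) hx
    hround.mem_convexHull (mem_interior_orthant.1 hround.mem_interior i)

theorem IsLinexp.pos (h : IsLinexp η S n w₁ l V p w) (hw₁ : ∀ i, 0 < w₁ i)
    (ht : t ∈ Finset.Icc 1 (n + 1)) (ω : Ω) (i : Fin d) : 0 < w t ω i := by
  obtain ⟨h1, hn⟩ := Finset.mem_Icc.1 ht
  obtain rfl | ⟨s, hs, rfl⟩ : t = 1 ∨ ∃ s, 1 ≤ s ∧ t = s + 1 := by
    rcases h1.eq_or_lt with h | h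
    exacts [.inl h.symm, .inr ⟨t - 1, by lia, by lia⟩]
  · rw [h.init ω]
    exact hw₁ i
  · exact mem_interior_orthant.1 (h.update s (Finset.mem_Icc.2 ⟨hs, by lia⟩) ω).mem_interior i

theorem IsLinexp.inner_sub_inner_estimate_le (h : IsLinexp η S n w₁ l V p w) (hη : 0 < η)
    (hw₁ : ∀ i, 0 < w₁ i) (ht : t ∈ Finset.Icc 1 n) {ω : Ω} (hl : ∀ i, 0 ≤ l t ω i)
    (hV : ∀ i, V t ω i ∈ Set.Icc (0 : ℝ) 1) (huS : u ∈ convexHull ℝ (S : Set (Vec d)))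
    (hu : u ∈ orthant d) :
    inner ℝ (l t ω) (V t ω) - inner ℝ (semiBanditEstimate (l t ω) (V t ω) (w t ω)) u ≤
      bregman (negEntropy η) u (w t ω) - bregman (negEntropy η) u (w (t + 1) ω) +
        η / 2 * ∑ i, l t ω i ^ 2 * (V t ω i / w t ω i) := by
  have hw := h.pos hw₁ (Finset.Icc_subset_Icc_right n.le_succ ht) ω
  have hstep := (h.update t ht ω).inner_sub_le_of_negEntropy hη hw
    (semiBanditEstimate_nonneg hl (fun i => (hV i).1) fun i => (hw i).le) huS hu
  rw [inner_sub_right, inner_semiBanditEstimate_self _ _ fun i => (hw i).ne'] at hstep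
  refine hstep.trans ?_
  gcongr _ + η / 2 * ?_
  exact Finset.sum_le_sum fun i _ => mul_semiBanditEstimate_sq_le (hV i) (hw i)

theorem IsLinexp.sum_inner_sub_inner_estimate_le (h : IsLinexp η S n w₁ l V p w) (hη : 0 < η)
    (hw₁ : ∀ i, 0 < w₁ i) {ω : Ω} (hl : ∀ t ∈ Finset.Icc 1 n, ∀ i, 0 ≤ l t ω i)
    (hV : ∀ t ∈ Finset.Icc 1 n, ∀ i, V t ω i ∈ Set.Icc (0 : ℝ) 1)
    (huS : u ∈ convexHull ℝ (S : Set (Vec d))) (hu : u ∈ orthant d) :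
    ∑ t ∈ Finset.Icc 1 n, (inner ℝ (l t ω) (V t ω) -
        inner ℝ (semiBanditEstimate (l t ω) (V t ω) (w t ω)) u) ≤
      bregman (negEntropy η) u w₁ +
        η / 2 * ∑ t ∈ Finset.Icc 1 n, ∑ i, l t ω i ^ 2 * (V t ω i / w t ω i) := by
  have hsum := Finset.sum_le_sum fun t ht =>
    h.inner_sub_inner_estimate_le hη hw₁ ht (hl t ht) (hV t ht) huS hu
  have htelescope : ∑ t ∈ Finset.Icc 1 n, (bregman (negEntropy η) u (w t ω) -
      bregman (negEntropy η) u (w (t + 1) ω)) =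
        bregman (negEntropy η) u w₁ - bregman (negEntropy η) u (w (n + 1) ω) := by
    rw [← Finset.Ico_add_one_right_eq_Icc, ← h.init ω]
    have := Finset.sum_Ico_sub (fun t => -bregman (negEntropy η) u (w t ω)) (Nat.le_add_left 1 n)
    simp only [neg_sub_neg] at this
    exact this
  rw [Finset.sum_add_distrib, htelescope, ← Finset.mul_sum] at hsum
  linarith [bregman_negEntropy_nonneg hη.le hu
    (h.pos hw₁ (Finset.right_mem_Icc.2 (Nat.le_add_left 1 n)) ω)]

end Linexp

section Game

variable {Ω : Type*} [mΩ : MeasurableSpace Ω] {μ : Measure Ω} {𝓕 : Filtration ℕ mΩ} {n t : ℕ}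
  {S : Finset (Vec d)} {l V w : ℕ → Ω → Vec d} {p : ℕ → Ω → Vec d → ℝ}

/-- The information available when the action `V t` is drawn: the past and the loss vector
`l t`. -/
abbrev drawInfo (𝓕 : Filtration ℕ mΩ) (l : ℕ → Ω → Vec d) (t : ℕ) : MeasurableSpace Ω :=
  𝓕 (t - 1) ⊔ MeasurableSpace.comap (l t) inferInstance

namespace IsGame

theorem drawInfo_le (h : IsGame μ 𝓕 S n l V p) (ht : t ∈ Finset.Icc 1 n) :
    drawInfo 𝓕 l t ≤ mΩ :=
  sup_le (𝓕.le _) ((h.loss_measurable t ht).comap_le.trans (𝓕.le t))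

theorem measurable_loss (h : IsGame μ 𝓕 S n l V p) (ht : t ∈ Finset.Icc 1 n) :
    Measurable (l t) :=
  (h.loss_measurable t ht).mono (𝓕.le t) le_rfl

theorem measurable_action (h : IsGame μ 𝓕 S n l V p) (ht : t ∈ Finset.Icc 1 n) :
    Measurable (V t) :=
  (h.action_measurable t ht).mono (𝓕.le t) le_rfl

theorem action_apply_eq_sum (h : IsGame μ 𝓕 S n l V p) (ht : t ∈ Finset.Icc 1 n) (i : Fin d) :
    (fun ω => V t ω i) = ∑ v ∈ S, v i • (V t ⁻¹' {v}).indicator fun _ => (1 : ℝ) := by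
  ext ω
  rw [Finset.sum_apply, Finset.sum_eq_single_of_mem (V t ω) (h.action_mem t ht ω)]
  · simp
  · intro v _ hv
    simp [hv.symm]

variable [IsFiniteMeasure μ]

theorem integrable_indicator_action (h : IsGame μ 𝓕 S n l V p) (ht : t ∈ Finset.Icc 1 n)
    (v : Vec d) : Integrable ((V t ⁻¹' {v}).indicator fun _ => (1 : ℝ)) μ :=
  (integrable_const 1).indicator (h.measurable_action ht (measurableSet_singleton v))

theorem integrable_action_apply (h : IsGame μ 𝓕 S n l V p) (ht : t ∈ Finset.Icc 1 n)
    (i : Fin d) : Integrable (fun ω => V t ω i) μ := by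
  rw [h.action_apply_eq_sum ht i]
  exact integrable_finsetSum' _ fun v _ => (h.integrable_indicator_action ht v).smul (v i)

theorem condExp_action_apply (h : IsGame μ 𝓕 S n l V p) (ht : t ∈ Finset.Icc 1 n)
    (hdist : ∀ ω, IsDistWithMean S (p t ω) (w t ω)) (i : Fin d) :
    μ[fun ω => V t ω i | drawInfo 𝓕 l t] =ᵐ[μ] fun ω => w t ω i := by
  have hlaw : ∀ᵐ ω ∂μ, ∀ v ∈ S, (μ[v i • (V t ⁻¹' {v}).indicator (fun _ => (1 : ℝ)) |
      drawInfo 𝓕 l t]) ω = v i * p t ω v := by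
    refine (Finset.eventually_all S).2 fun v hv => ?_
    filter_upwards [condExp_smul (μ := μ) (v i) ((V t ⁻¹' {v}).indicator fun _ => (1 : ℝ))
      (drawInfo 𝓕 l t), h.action_law t ht v hv] with ω hsmul hω
    rw [hsmul, Pi.smul_apply, hω, smul_eq_mul]
  rw [h.action_apply_eq_sum ht i]
  filter_upwards [hlaw, condExp_finsetSum (s := S) (fun v _ =>
    (h.integrable_indicator_action ht v).smul (v i)) (drawInfo 𝓕 l t)] with ω hω hsum
  rw [hsum, Finset.sum_apply, Finset.sum_congr rfl hω, ← (hdist ω).mean_eq]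
  simp [mul_comm]

section ImportanceWeighting

variable {G : Vec d → ℝ} {i : Fin d}

theorem stronglyMeasurable_comp_loss (hG : Measurable G) :
    StronglyMeasurable[drawInfo 𝓕 l t] fun ω => G (l t ω) :=
  have hl : Measurable[drawInfo 𝓕 l t] (l t) := .of_comap_le le_sup_right
  (hG.comp hl).stronglyMeasurable

theorem integrable_comp_loss_mul_div (h : IsGame μ 𝓕 S n l V p) (ht : t ∈ Finset.Icc 1 n)
    (hdist : ∀ ω, IsDistWithMean S (p t ω) (w t ω)) (hS : ∀ v ∈ S, 0 ≤ v i) (hG : Measurable G)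
    (hint : Integrable (fun ω => G (l t ω)) μ) :
    Integrable (fun ω => G (l t ω) * (V t ω i / w t ω i)) μ := by
  refine (integrable_mul_div_condExp (h.drawInfo_le ht) (stronglyMeasurable_comp_loss hG) hint
    (h.integrable_action_apply ht i) (.of_forall fun ω => hS _ (h.action_mem t ht ω))).congr ?_
  filter_upwards [h.condExp_action_apply ht hdist i] with ω hω
  rw [hω]

theorem integral_comp_loss_mul_div (h : IsGame μ 𝓕 S n l V p) (ht : t ∈ Finset.Icc 1 n)
    (hdist : ∀ ω, IsDistWithMean S (p t ω) (w t ω)) (hS : ∀ v ∈ S, 0 ≤ v i)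
    (hw : ∀ ω, 0 < w t ω i) (hG : Measurable G) (hint : Integrable (fun ω => G (l t ω)) μ) :
    ∫ ω, G (l t ω) * (V t ω i / w t ω i) ∂μ = ∫ ω, G (l t ω) ∂μ := by
  have hcond := h.condExp_action_apply ht hdist i
  rw [← integral_mul_div_condExp (h.drawInfo_le ht) (stronglyMeasurable_comp_loss hG) hint
    (h.integrable_action_apply ht i) (.of_forall fun ω => hS _ (h.action_mem t ht ω))
    (hcond.mono fun ω hω => hω.trans_ne (hw ω).ne')]
  refine integral_congr_ae ?_
  filter_upwards [hcond] with ω hω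
  rw [hω]

end ImportanceWeighting

theorem integrable_inner_semiBanditEstimate (h : IsGame μ 𝓕 S n l V p) (ht : t ∈ Finset.Icc 1 n)
    (hdist : ∀ ω, IsDistWithMean S (p t ω) (w t ω)) (hS : (S : Set (Vec d)) ⊆ orthant d)
    (hl : Integrable (l t) μ) (u : Vec d) :
    Integrable (fun ω => inner ℝ (semiBanditEstimate (l t ω) (V t ω) (w t ω)) u) μ := by
  simp only [PiLp.inner_apply, semiBanditEstimate, RCLike.inner_apply, conj_trivial]
  exact integrable_finsetSum _ fun i _ => (h.integrable_comp_loss_mul_div ht hdist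
    (G := fun x => x i) (fun v hv => hS hv i) (by fun_prop) (hl.eval_piLp i)).const_mul (u i)

theorem integral_inner_semiBanditEstimate (h : IsGame μ 𝓕 S n l V p) (ht : t ∈ Finset.Icc 1 n)
    (hdist : ∀ ω, IsDistWithMean S (p t ω) (w t ω)) (hS : (S : Set (Vec d)) ⊆ orthant d)
    (hw : ∀ ω i, 0 < w t ω i) (hl : Integrable (l t) μ) (u : Vec d) :
    ∫ ω, inner ℝ (semiBanditEstimate (l t ω) (V t ω) (w t ω)) u ∂μ =
      ∫ ω, inner ℝ (l t ω) u ∂μ := by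
  simp only [PiLp.inner_apply, semiBanditEstimate, RCLike.inner_apply, conj_trivial]
  have hli := hl.eval_piLp
  rw [integral_finsetSum _ fun i _ => (h.integrable_comp_loss_mul_div ht hdist
    (G := fun x => x i) (fun v hv => hS hv i) (by fun_prop) (hli i)).const_mul (u i),
    integral_finsetSum _ fun i _ => (hli i).const_mul (u i)]
  refine Finset.sum_congr rfl fun i _ => ?_
  rw [integral_const_mul, integral_const_mul, h.integral_comp_loss_mul_div ht hdist
    (G := fun x => x i) (fun v hv => hS hv i) (hw · i) (by fun_prop) (hli i)]

theorem integrable_inner_action (h : IsGame μ 𝓕 S n l V p) (ht : t ∈ Finset.Icc 1 n)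
    (hS : ∀ v ∈ S, ∀ i, v i ∈ Set.Icc (0 : ℝ) 1) (hl : Integrable (l t) μ) :
    Integrable (fun ω => inner ℝ (l t ω) (V t ω)) μ := by
  simp only [PiLp.inner_apply, RCLike.inner_apply, conj_trivial]
  refine integrable_finsetSum _ fun i _ => (hl.eval_piLp i).bdd_mul (c := 1)
    (h.integrable_action_apply ht i).1 (.of_forall fun ω => ?_)
  have hVi := hS _ (h.action_mem t ht ω) i
  rw [Real.norm_of_nonneg hVi.1]
  exact hVi.2

theorem integrable_inner_sub_inner_estimate (h : IsGame μ 𝓕 S n l V p)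
    (ht : t ∈ Finset.Icc 1 n) (hdist : ∀ ω, IsDistWithMean S (p t ω) (w t ω))
    (hS : ∀ v ∈ S, ∀ i, v i ∈ Set.Icc (0 : ℝ) 1) (hl : Integrable (l t) μ) (u : Vec d) :
    Integrable (fun ω => inner ℝ (l t ω) (V t ω) -
      inner ℝ (semiBanditEstimate (l t ω) (V t ω) (w t ω)) u) μ :=
  (h.integrable_inner_action ht hS hl).sub
    (h.integrable_inner_semiBanditEstimate ht hdist (fun v hv i => (hS v hv i).1) hl u)

theorem integral_sum_inner_sub_inner_estimate (h : IsGame μ 𝓕 S n l V p)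
    (hdist : ∀ t ∈ Finset.Icc 1 n, ∀ ω, IsDistWithMean S (p t ω) (w t ω))
    (hS : ∀ v ∈ S, ∀ i, v i ∈ Set.Icc (0 : ℝ) 1) (hw : ∀ t ∈ Finset.Icc 1 n, ∀ ω i, 0 < w t ω i)
    (hl : ∀ t ∈ Finset.Icc 1 n, Integrable (l t) μ) (u : Vec d) :
    ∫ ω, ∑ t ∈ Finset.Icc 1 n, (inner ℝ (l t ω) (V t ω) -
        inner ℝ (semiBanditEstimate (l t ω) (V t ω) (w t ω)) u) ∂μ =
      (∫ ω, ∑ t ∈ Finset.Icc 1 n, inner ℝ (l t ω) (V t ω) ∂μ) -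
        ∫ ω, ∑ t ∈ Finset.Icc 1 n, inner ℝ (l t ω) u ∂μ := by
  have hS0 : (S : Set (Vec d)) ⊆ orthant d := fun v hv i => (hS v hv i).1
  rw [integral_finsetSum _ fun t ht =>
      h.integrable_inner_sub_inner_estimate ht (hdist t ht) hS (hl t ht) u,
    integral_finsetSum _ fun t ht => h.integrable_inner_action ht hS (hl t ht),
    integral_finsetSum _ fun t ht => (hl t ht).inner_const u, ← Finset.sum_sub_distrib]
  refine Finset.sum_congr rfl fun t ht => ?_
  rw [integral_sub (h.integrable_inner_action ht hS (hl t ht))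
      (h.integrable_inner_semiBanditEstimate ht (hdist t ht) hS0 (hl t ht) u),
    h.integral_inner_semiBanditEstimate ht (hdist t ht) hS0 (hw t ht) (hl t ht)]

theorem integrable_sum_sq_mul_div (h : IsGame μ 𝓕 S n l V p) (ht : t ∈ Finset.Icc 1 n)
    (hdist : ∀ ω, IsDistWithMean S (p t ω) (w t ω)) (hS : (S : Set (Vec d)) ⊆ orthant d)
    (hl : MemLp (l t) 2 μ) :
    Integrable (fun ω => ∑ i, l t ω i ^ 2 * (V t ω i / w t ω i)) μ :=
  integrable_finsetSum _ fun i _ => h.integrable_comp_loss_mul_div ht hdist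
    (G := fun x => x i ^ 2) (fun v hv => hS hv i) (by fun_prop) (hl.eval_piLp i).integrable_sq

theorem integral_sum_sq_mul_div (h : IsGame μ 𝓕 S n l V p) (ht : t ∈ Finset.Icc 1 n)
    (hdist : ∀ ω, IsDistWithMean S (p t ω) (w t ω)) (hS : (S : Set (Vec d)) ⊆ orthant d)
    (hw : ∀ ω i, 0 < w t ω i) (hl : MemLp (l t) 2 μ) :
    ∫ ω, ∑ i, l t ω i ^ 2 * (V t ω i / w t ω i) ∂μ = ∫ ω, ‖l t ω‖ ^ 2 ∂μ := by
  have hli : ∀ i, Integrable (fun ω => l t ω i ^ 2) μ := fun i => (hl.eval_piLp i).integrable_sq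
  simp only [EuclideanSpace.real_norm_sq_eq]
  rw [integral_finsetSum _ fun i _ => h.integrable_comp_loss_mul_div ht hdist
    (G := fun x => x i ^ 2) (fun v hv => hS hv i) (by fun_prop) (hli i),
    integral_finsetSum _ fun i _ => hli i]
  exact Finset.sum_congr rfl fun i _ => h.integral_comp_loss_mul_div ht hdist
    (G := fun x => x i ^ 2) (fun v hv => hS hv i) (hw · i) (by fun_prop) (hli i)

theorem memLp_loss_of_abs_le_one (h : IsGame μ 𝓕 S n l V p) (ht : t ∈ Finset.Icc 1 n)
    (hl : ∀ ω i, |l t ω i| ≤ 1) (q : ENNReal) : MemLp (l t) q μ :=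
  MemLp.of_eval_piLp fun i => .of_bound
    (by have := h.measurable_loss ht; fun_prop) 1 (.of_forall fun ω => hl ω i)

end IsGame

theorem sum_integral_norm_sq_le {l : ℕ → Ω → Vec d} [IsProbabilityMeasure μ]
    (hl : ∀ t ∈ Finset.Icc 1 n, ∀ ω i, |l t ω i| ≤ 1) :
    ∑ t ∈ Finset.Icc 1 n, ∫ ω, ‖l t ω‖ ^ 2 ∂μ ≤ n * d := by
  have hnorm : ∀ t ∈ Finset.Icc 1 n, ∀ ω, ‖l t ω‖ ^ 2 ≤ d := fun t ht ω => by
    calc ‖l t ω‖ ^ 2 = ∑ i, l t ω i ^ 2 := EuclideanSpace.real_norm_sq_eq _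
      _ ≤ ∑ _i : Fin d, (1 : ℝ) :=
        Finset.sum_le_sum fun i _ => (sq_le_one_iff_abs_le_one _).2 (hl t ht ω i)
      _ = d := by simp
  have hround : ∀ t ∈ Finset.Icc 1 n, ∫ ω, ‖l t ω‖ ^ 2 ∂μ ≤ d := fun t ht => by
    refine (integral_mono_of_nonneg (.of_forall fun ω => sq_nonneg _)
      (integrable_const (d : ℝ)) (.of_forall (hnorm t ht))).trans_eq ?_
    simp
  simpa using Finset.sum_le_card_nsmul _ _ _ hround

end Game

section Regret

variable {Ω : Type*} [mΩ : MeasurableSpace Ω] {μ : Measure Ω} [IsProbabilityMeasure μ]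
  {𝓕 : Filtration ℕ mΩ} {n : ℕ} {η : ℝ} {S : Finset (Vec d)} {u w₁ : Vec d}
  {l V w : ℕ → Ω → Vec d} {p : ℕ → Ω → Vec d → ℝ}

theorem IsLinexp.expected_loss_sub_le (hlinexp : IsLinexp η S n w₁ l V p w)
    (hgame : IsGame μ 𝓕 S n l V p) (hη : 0 < η) (hS : ∀ v ∈ S, ∀ i, v i ∈ Set.Icc (0 : ℝ) 1)
    (hl : ∀ t ∈ Finset.Icc 1 n, MemLp (l t) 2 μ) (hw₁ : ∀ i, 0 < w₁ i)
    (hu : u ∈ convexHull ℝ (S : Set (Vec d))) :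
    (∫ ω, ∑ t ∈ Finset.Icc 1 n, inner ℝ (l t ω) (V t ω) ∂μ) -
        ∫ ω, ∑ t ∈ Finset.Icc 1 n, inner ℝ (l t ω) u ∂μ ≤
      bregman (negEntropy η) u w₁ + η / 2 * ∑ t ∈ Finset.Icc 1 n, ∫ ω, ‖l t ω‖ ^ 2 ∂μ := by
  have hS0 : (S : Set (Vec d)) ⊆ orthant d := fun v hv i => (hS v hv i).1
  have hw : ∀ t ∈ Finset.Icc 1 n, ∀ ω i, 0 < w t ω i := fun t ht =>
    hlinexp.pos hw₁ (Finset.Icc_subset_Icc_right n.le_succ ht)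
  have hl₁ : ∀ t ∈ Finset.Icc 1 n, Integrable (l t) μ := fun t ht =>
    (hl t ht).integrable one_le_two
  have hsq := fun t ht => hgame.integrable_sum_sq_mul_div ht (hlinexp.dist t ht) hS0 (hl t ht)
  have hB := integrable_const (μ := μ) (bregman (negEntropy η) u w₁)
  have hQ := (integrable_finsetSum _ hsq).const_mul (η / 2)
  rw [← hgame.integral_sum_inner_sub_inner_estimate hlinexp.dist hS hw hl₁ u]
  calc ∫ ω, ∑ t ∈ Finset.Icc 1 n, (inner ℝ (l t ω) (V t ω) -
          inner ℝ (semiBanditEstimate (l t ω) (V t ω) (w t ω)) u) ∂μ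
      ≤ ∫ ω, (bregman (negEntropy η) u w₁ +
          η / 2 * ∑ t ∈ Finset.Icc 1 n, ∑ i, l t ω i ^ 2 * (V t ω i / w t ω i)) ∂μ :=
        integral_mono (integrable_finsetSum _ fun t ht =>
            hgame.integrable_inner_sub_inner_estimate ht (hlinexp.dist t ht) hS (hl₁ t ht) u)
          (hB.add hQ) fun ω => hlinexp.sum_inner_sub_inner_estimate_le hη hw₁
            (fun t ht => hgame.loss_nonneg t ht ω) (fun t ht => hS _ (hgame.action_mem t ht ω)) hu
            (convexHull_min hS0 (convex_orthant d) hu)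
    _ = bregman (negEntropy η) u w₁ + η / 2 * ∑ t ∈ Finset.Icc 1 n, ∫ ω, ‖l t ω‖ ^ 2 ∂μ := by
        rw [integral_add hB hQ, integral_const_mul, integral_finsetSum _ hsq, integral_const,
          probReal_univ, one_smul, Finset.sum_congr rfl fun t ht =>
            hgame.integral_sum_sq_mul_div ht (hlinexp.dist t ht) hS0 (hw t ht) (hl t ht)]

end Regret

theorem div_sqrt_add_le {a b c : ℝ} (ha : 0 < a) (hb : b ≤ a * c) :
    c / √(2 / a) + √(2 / a) / 2 * b ≤ c * √(2 * a) := by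
  have hpos : 0 < √(2 / a) := by positivity
  have hsq : √(2 / a) ^ 2 * a = 2 := by
    rw [Real.sq_sqrt (by positivity), div_mul_cancel₀ _ ha.ne']
  have hsqrt : √(2 * a) = √(2 / a) * a := by
    rw [← Real.sqrt_sq (mul_pos hpos ha).le, mul_pow, sq a, ← mul_assoc, hsq]
  calc c / √(2 / a) + √(2 / a) / 2 * b ≤ c / √(2 / a) + √(2 / a) / 2 * (a * c) := by gcongr
    _ = c * √(2 * a) := by
      rw [hsqrt]
      field_simp
      linear_combination -c * hsq

end CombPred

theorem mainTheorem5_general {Ω : Type*} [mΩ : MeasurableSpace Ω] (μ : Measure Ω)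
    [IsProbabilityMeasure μ] (𝓕 : Filtration ℕ mΩ) (d n : ℕ) (hn : 1 ≤ n)
    (S : Finset (CombPred.Vec d)) (hS : S.Nonempty)
    (hS01 : ∀ v ∈ S, ∀ i, v i ∈ Set.Icc (0 : ℝ) 1)
    (l V w : ℕ → Ω → CombPred.Vec d) (p : ℕ → Ω → CombPred.Vec d → ℝ)
    (hgame : CombPred.IsGame μ 𝓕 S n l V p) (hl : ∀ t ∈ Finset.Icc 1 n, MemLp (l t) 2 μ)
    (η : ℝ) (hη : 0 < η) (w₁ : CombPred.Vec d)
    (hw₁ : CombPred.IsBregmanProj (CombPred.negEntropy η)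
      (convexHull ℝ (S : Set (CombPred.Vec d))) (WithLp.toLp 2 fun _ => 1) w₁)
    (hlinexp : CombPred.IsLinexp η S n w₁ l V p w) :
    CombPred.regret μ S hS n l V ≤
      d / η + η / 2 * ∑ t ∈ Finset.Icc 1 n, ∫ ω, ‖l t ω‖ ^ 2 ∂μ := by
  have hS0 : (S : Set (CombPred.Vec d)) ⊆ CombPred.orthant d := fun v hv i => (hS01 v hv i).1
  have := nonempty_of_isProbabilityMeasure μ
  have hpos : ∀ i, 0 < w₁ i := hlinexp.init_pos hn hη hS0 (fun _ => one_pos) hw₁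
  obtain ⟨u, hu, hmin⟩ := S.exists_mem_eq_inf' hS
    fun v => ∫ ω, ∑ t ∈ Finset.Icc 1 n, inner ℝ (l t ω) v ∂μ
  have huS : u ∈ convexHull ℝ (S : Set (CombPred.Vec d)) := subset_convexHull ℝ _ hu
  have hregret := hlinexp.expected_loss_sub_le hgame hη hS01 hl hpos huS
  have hpyth := hw₁.bregman_add_bregman_le
    (CombPred.hasGradientAt_negEntropy η hpos).differentiableAt
    ((convex_convexHull ℝ _).openSegment_subset hw₁.1 huS)
  have hproj : 0 ≤ CombPred.bregman (CombPred.negEntropy η) w₁ (WithLp.toLp 2 fun _ => 1) :=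
    CombPred.bregman_negEntropy_nonneg hη.le (fun i => (hpos i).le) fun _ => one_pos
  rw [CombPred.regret, hmin]
  linarith [CombPred.bregman_negEntropy_one_le hη.le (hS01 u hu)]

theorem mainTheorem5 {Ω : Type*} [mΩ : MeasurableSpace Ω] (μ : Measure Ω) [IsProbabilityMeasure μ]
    (𝓕 : Filtration ℕ mΩ) (d n : ℕ) (hn : 1 ≤ n)
    (S : Finset (CombPred.Vec d)) (hS : S.Nonempty)
    (hS01 : ∀ v ∈ S, ∀ i, v i = 0 ∨ v i = 1)
    (hScov : ∀ i, ∃ v ∈ S, v i = 1)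
    (l V w : ℕ → Ω → CombPred.Vec d) (p : ℕ → Ω → CombPred.Vec d → ℝ)
    (hgame : CombPred.IsGame μ 𝓕 S n l V p)
    (hLinf : ∀ t ∈ Finset.Icc 1 n, ∀ ω i, |l t ω i| ≤ 1)
    (η : ℝ) (hη : η = √(2 / (n : ℝ)))
    (w₁ : CombPred.Vec d)
    (hw₁ : CombPred.IsBregmanProj (CombPred.negEntropy η)
      (convexHull ℝ (S : Set (CombPred.Vec d))) (WithLp.toLp 2 fun _ => 1) w₁)
    (hlinexp : CombPred.IsLinexp η S n w₁ l V p w) :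
    CombPred.regret μ S hS n l V ≤ d * √(2 * n) := by
  subst hη
  have hn0 : (0 : ℝ) < n := Nat.cast_pos.2 hn
  exact (mainTheorem5_general μ 𝓕 d n hn S hS
    (fun v hv i => by rcases hS01 v hv i with h | h <;> simp [h]) l V w p hgame
    (fun t ht => hgame.memLp_loss_of_abs_le_one ht (hLinf t ht) 2) _ (by positivity) w₁ hw₁
    hlinexp).trans (CombPred.div_sqrt_add_le hn0 (CombPred.sum_integral_norm_sq_le hLinf))
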